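/- Let $\mathbf{Rel}$ be the category of sets and relations with its standard dagger compact structure: the tensor product is the cartesian product, $R^\dagger$ is the converse of $R$, every set is its own dual, and the cup $I\to A^*\otimes A$ and the cap $A^*\otimes A\to I$ are the diagonal relations. A morphism $f\colon A^*\otimes A\to B^*\otimes B$ of $\mathbf{Rel}$ is *completely positive* if it equals $(\mathrm{id}_{B^*}\otimes \mathrm{cap}_C\otimes \mathrm{id}_B)\circ(g_*\otimes g)$ for some object $C$ and some $g\colon A\to C\otimes B$, where $g_*\colon A^*\to B^*\otimes C^*$ is the conjugate of $g$. The dagger category $\mathrm{CPM}[\mathbf{Rel}]$ has sets as objects and completely positive maps $A^*\otimes A\to B^*\otimes B$ as morphisms $A\to B$. For a dagger category $\mathbf{V}$, the category $\mathrm{Split}^\dagger[\mathbf{V}]$ has as objects the pairs $(X,p)$ with $p\colon X\to X$ satisfying $p^\dagger=p=p\circ p$, and as morphisms $(X,p)\to(Y,q)$ the morphisms $f\colon X\to Y$ of $\mathbf{V}$ with $f=q\circ f\circ p$. A *dagger Frobenius algebra* in $\mathbf{Rel}$ is an object $A$ with an associative multiplication $m\colon A\otimes A\to A$ that has a unit $u\colon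 I\to A$ and satisfies $(m\otimes\mathrm{id})\circ(\mathrm{id}\otimes m^\dagger)=m^\dagger\circ m=(\mathrm{id}\otimes m)\circ(m^\dagger\otimes\mathrm{id})$. Its action is $a_A=(\mathrm{id}_{A^*}\otimes m)\circ(\mathrm{cup}_A\otimes\mathrm{id}_A)\colon A\to A^*\otimes A$, and its coaction is $a_A^\dagger$. It is *normalisable* if it comes with an isomorphism $z_A\colon A\to A$ that is central ($m\circ(z_A\otimes\mathrm{id})=z_A\circ m=m\circ(\mathrm{id}\otimes z_A)$), positive ($z_A=h^\dagger\circ h$ for some $h$), and satisfies $\mathrm{cap}_A\circ a_A\circ z_A\circ z_A=u^\dagger$. The category $\mathrm{CP}^*[\mathbf{Rel}]$ has the normalisable dagger Frobenius algebras in $\mathbf{Rel}$ as objects, and as morphisms $A\to B$ the relations $f\colon A\to B$ such that $a_B\circ f\circ a_A^\dagger$ is completely positive. Let $F\colon \mathrm{CP}^*[\mathbf{Rel}]\to\mathrm{Split}^\dagger[\mathrm{CPM}[\mathbf{Rel}]]$ be the canonical functor, given on objects by $F(A)=(A,\;a_A\circ z_A\circ z_A\circ a_A^\dagger)$ and on morphisms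 $f\colon A\to B$ by $F(f)=a_B\circ z_B\circ f\circ z_A\circ a_A^\dagger$. Then $F$ is not an equivalence of categories. -/

import Mathlib

open CategoryTheory MonoidalCategory

/-! ## Dagger categories, dagger Frobenius algebras, splitting of dagger idempotents -/

universe v u

/-- A dagger category: an identity-on-objects, involutive, contravariant operation on morphisms. -/
class DaggerCategory (V : Type u) [Category.{v} V] where
  dagger {X Y : V} : (X ⟶ Y) → (Y ⟶ X)
  dagger_id (X : V) : dagger (𝟙 X) = 𝟙 X
  dagger_comp {X Y Z : V} (f : X ⟶ Y) (g : Y ⟶ Z) : dagger (f ≫ g) = dagger g ≫ dagger f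
  dagger_dagger {X Y : V} (f : X ⟶ Y) : dagger (dagger f) = f

open DaggerCategory

/-- A dagger Frobenius algebra in a monoidal dagger category. -/
structure DaggerFrobeniusAlgebra (V : Type u) [Category.{v} V] [MonoidalCategory V]
    [DaggerCategory V] where
  carrier : V
  mul : carrier ⊗ carrier ⟶ carrier
  unit : 𝟙_ V ⟶ carrier
  assoc : (mul ▷ carrier) ≫ mul = (α_ carrier carrier carrier).hom ≫ (carrier ◁ mul) ≫ mul
  unit_mul : (unit ▷ carrier) ≫ mul = (λ_ carrier).hom
  mul_unit : (carrier ◁ unit) ≫ mul = (ρ_ carrier).hom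
  frobenius_left :
    (carrier ◁ dagger mul) ≫ (α_ carrier carrier carrier).inv ≫ (mul ▷ carrier) = mul ≫ dagger mul
  frobenius_right :
    (dagger mul ▷ carrier) ≫ (α_ carrier carrier carrier).hom ≫ (carrier ◁ mul) = mul ≫ dagger mul

/-- `z` is central for the multiplication of `A`. -/
def DaggerFrobeniusAlgebra.IsCentral {V : Type u} [Category.{v} V] [MonoidalCategory V]
    [DaggerCategory V] (A : DaggerFrobeniusAlgebra V) (z : A.carrier ⟶ A.carrier) : Prop :=
  (z ▷ A.carrier) ≫ A.mul = A.mul ≫ z ∧ (A.carrier ◁ z) ≫ A.mul = A.mul ≫ z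

/-- An endomorphism is positive when it is of the form `h† ∘ h`. -/
def IsPositiveMor {V : Type u} [Category.{v} V] [DaggerCategory V] {X : V} (g : X ⟶ X) : Prop :=
  ∃ (Y : V) (h : X ⟶ Y), g = h ≫ dagger h

/-- An object of `Split†[V]`: an object of `V` with a dagger idempotent on it. -/
structure SplitDagger (V : Type u) [Category.{v} V] [DaggerCategory V] where
  X : V
  p : X ⟶ X
  dagger_p : dagger p = p
  idem : p ≫ p = p

namespace SplitDagger

variable {V : Type u} [Category.{v} V] [DaggerCategory V]

/-- A morphism `(X, p) ⟶ (Y, q)` of `Split†[V]`: a morphism `f` of `V` with `f = q ∘ f ∘ p`. -/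
@[ext]
structure Hom (P Q : SplitDagger V) where
  hom : P.X ⟶ Q.X
  comm : hom = P.p ≫ hom ≫ Q.p

theorem Hom.p_comp {P Q : SplitDagger V} (f : Hom P Q) : P.p ≫ f.hom = f.hom := by
  rw [f.comm, ← Category.assoc, P.idem]

theorem Hom.comp_p {P Q : SplitDagger V} (f : Hom P Q) : f.hom ≫ Q.p = f.hom := by
  rw [f.comm, Category.assoc, Category.assoc, Q.idem]

instance : Category (SplitDagger V) where
  Hom := Hom
  id P := ⟨P.p, by rw [P.idem, P.idem]⟩
  comp {P Q R} f g := ⟨f.hom ≫ g.hom, by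
    rw [Category.assoc, g.comp_p, ← Category.assoc, f.p_comp]⟩
  id_comp f := Hom.ext f.p_comp
  comp_id f := Hom.ext f.comp_p
  assoc _ _ _ := Hom.ext (Category.assoc _ _ _)

end SplitDagger

/-! ## The dagger compact structure of `Rel`

The tensor product is the cartesian product of sets, the dagger is the converse relation, and every
set is its own dual, with cup the diagonal relation. -/

namespace RelDaggerCompact

/-- The underlying set of an object of `Rel`. -/
def El (X : RelCat.{u}) : Type u := X

/-- A set as an object of `Rel`. -/
def of (S : Type u) : RelCat.{u} := S

/-- The morphism of `Rel` given by a binary relation. -/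
def ofPred {X Y : RelCat.{u}} (r : El X → El Y → Prop) : X ⟶ Y :=
  CategoryTheory.RelCat.Hom.ofRel {p | r p.1 p.2}

/-- `x` and `y` are related by the morphism `f` of `Rel`. -/
def Holds {X Y : RelCat.{u}} (f : X ⟶ Y) (x : El X) (y : El Y) : Prop :=
  (x, y) ∈ CategoryTheory.RelCat.Hom.rel f

variable {X Y Z W : RelCat.{u}}

theorem hom_ext' {f g : X ⟶ Y} (h : ∀ x y, Holds f x y ↔ Holds g x y) : f = g := by
  apply CategoryTheory.RelCat.Hom.ext
  ext ⟨x, y⟩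
  exact h x y

theorem holds_congr {f g : X ⟶ Y} (h : f = g) (x : El X) (y : El Y) : Holds f x y ↔ Holds g x y := by
  rw [h]

@[simp] theorem holds_ofPred (r : El X → El Y → Prop) (x : El X) (y : El Y) :
    Holds (ofPred r) x y ↔ r x y := Iff.rfl

@[simp] theorem holds_id (x y : El X) : Holds (𝟙 X) x y ↔ x = y := Iff.rfl

@[simp] theorem holds_comp (f : X ⟶ Y) (g : Y ⟶ Z) (x : El X) (z : El Z) :
    Holds (f ≫ g) x z ↔ ∃ y, Holds f x y ∧ Holds g y z := Iff.rfl

/-- The isomorphism of `Rel` given by a bijection. -/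
def isoOfEquiv (e : El X ≃ El Y) : X ≅ Y where
  hom := ofPred fun x y => e x = y
  inv := ofPred fun y x => e x = y
  hom_inv_id := hom_ext' fun x y => by simp [eq_comm]
  inv_hom_id := hom_ext' fun x y => by
    simp only [holds_comp, holds_ofPred, holds_id]
    exact ⟨fun ⟨a, h, k⟩ => h ▸ k, fun h => ⟨e.symm x, by simp, by simpa using h⟩⟩

@[simp] theorem holds_isoOfEquiv_hom (e : El X ≃ El Y) (x : El X) (y : El Y) :
    Holds (isoOfEquiv e).hom x y ↔ e x = y := Iff.rfl

@[simp] theorem holds_isoOfEquiv_inv (e : El X ≃ El Y) (x : El X) (y : El Y) :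
    Holds (isoOfEquiv e).inv y x ↔ e x = y := Iff.rfl

instance : MonoidalCategoryStruct RelCat.{u} where
  tensorObj X Y := of (El X × El Y)
  whiskerLeft X _ _ f := ofPred fun (p : El X × _) q => p.1 = q.1 ∧ Holds f p.2 q.2
  whiskerRight f Z := ofPred fun (p : _ × El Z) q => Holds f p.1 q.1 ∧ p.2 = q.2
  tensorHom f g := ofPred fun p q => Holds f p.1 q.1 ∧ Holds g p.2 q.2
  tensorUnit := of PUnit.{u + 1}
  associator X Y Z := isoOfEquiv (Equiv.prodAssoc (El X) (El Y) (El Z))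
  leftUnitor X := isoOfEquiv (Equiv.punitProd (El X))
  rightUnitor X := isoOfEquiv (Equiv.prodPUnit (El X))

/-- The element of `X ⊗ Y` with components `x` and `y`. -/
def pair (x : El X) (y : El Y) : El (X ⊗ Y : RelCat.{u}) := ((x, y) : El X × El Y)

/-- The element of the tensor unit. -/
def pt : El (𝟙_ RelCat.{u}) := PUnit.unit

@[simp] theorem pair_inj (x x' : El X) (y y' : El Y) : pair x y = pair x' y' ↔ x = x' ∧ y = y' :=
  Prod.mk_inj

@[simp] theorem forall_tensor {p : El (X ⊗ Y : RelCat.{u}) → Prop} :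
    (∀ q, p q) ↔ ∀ x y, p (pair x y) :=
  ⟨fun h _ _ => h _, fun h q => h q.1 q.2⟩

@[simp] theorem exists_tensor {p : El (X ⊗ Y : RelCat.{u}) → Prop} :
    (∃ q, p q) ↔ ∃ x y, p (pair x y) :=
  ⟨fun ⟨q, h⟩ => ⟨q.1, q.2, h⟩, fun ⟨_, _, h⟩ => ⟨_, h⟩⟩

@[simp] theorem forall_unit {p : El (𝟙_ RelCat.{u}) → Prop} : (∀ q, p q) ↔ p pt :=
  ⟨fun h => h _, fun h _ => h⟩

@[simp] theorem exists_unit {p : El (𝟙_ RelCat.{u}) → Prop} : (∃ q, p q) ↔ p pt :=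
  ⟨fun ⟨_, h⟩ => h, fun h => ⟨_, h⟩⟩

@[simp] theorem holds_whiskerLeft (f : Y ⟶ Z) (x x' : El X) (y : El Y) (z : El Z) :
    Holds (X ◁ f) (pair x y) (pair x' z) ↔ x = x' ∧ Holds f y z := Iff.rfl

@[simp] theorem holds_whiskerRight (f : Y ⟶ Z) (x x' : El X) (y : El Y) (z : El Z) :
    Holds (f ▷ X) (pair y x) (pair z x') ↔ Holds f y z ∧ x = x' := Iff.rfl

@[simp] theorem holds_tensorHom (f : X ⟶ Y) (g : Z ⟶ W) (x : El X) (y : El Y) (z : El Z) (w : El W) :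
    Holds (f ⊗ₘ g) (pair x z) (pair y w) ↔ Holds f x y ∧ Holds g z w := Iff.rfl

@[simp] theorem holds_associator_hom (x x' : El X) (y y' : El Y) (z z' : El Z) :
    Holds (α_ X Y Z).hom (pair (pair x y) z) (pair x' (pair y' z')) ↔ x = x' ∧ y = y' ∧ z = z' := by
  refine (holds_isoOfEquiv_hom _ _ _).trans ?_
  exact (pair_inj _ _ _ _).trans (and_congr_right fun _ => pair_inj _ _ _ _)

@[simp] theorem holds_associator_inv (x x' : El X) (y y' : El Y) (z z' : El Z) :
    Holds (α_ X Y Z).inv (pair x (pair y z)) (pair (pair x' y') z') ↔ x = x' ∧ y = y' ∧ z = z' := by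
  refine (holds_associator_hom x' x y' y z' z).trans ?_
  simp only [eq_comm]

@[simp] theorem holds_leftUnitor_hom (x x' : El X) :
    Holds (λ_ X).hom (pair pt x) x' ↔ x = x' := Iff.rfl

@[simp] theorem holds_leftUnitor_inv (x x' : El X) :
    Holds (λ_ X).inv x (pair pt x') ↔ x' = x := Iff.rfl

@[simp] theorem holds_rightUnitor_hom (x x' : El X) :
    Holds (ρ_ X).hom (pair x pt) x' ↔ x = x' := Iff.rfl

@[simp] theorem holds_rightUnitor_inv (x x' : El X) :
    Holds (ρ_ X).inv x (pair x' pt) ↔ x' = x := Iff.rfl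

instance : MonoidalCategory RelCat.{u} where
  tensorHom_def f g := hom_ext' (by simp)
  id_tensorHom_id X Y := hom_ext' (by simp)
  tensorHom_comp_tensorHom f g h k := hom_ext' (by simp; grind)
  whiskerLeft_id X Y := hom_ext' (by simp)
  id_whiskerRight X Y := hom_ext' (by simp)
  associator_naturality f g h := hom_ext' (by simp; grind)
  leftUnitor_naturality f := hom_ext' (by simp)
  rightUnitor_naturality f := hom_ext' (by simp)
  pentagon X Y Z W := hom_ext' (by simp; grind)
  triangle X Y := hom_ext' (by simp)

/-- The symmetry of `Rel`. -/
def swap (X Y : RelCat.{u}) : X ⊗ Y ≅ Y ⊗ X :=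
  isoOfEquiv (Equiv.prodComm (El X) (El Y))

@[simp] theorem holds_swap_hom (x x' : El X) (y y' : El Y) :
    Holds (swap X Y).hom (pair x y) (pair y' x') ↔ x = x' ∧ y = y' :=
  (pair_inj _ _ _ _).trans and_comm

@[simp] theorem holds_swap_inv (x x' : El X) (y y' : El Y) :
    Holds (swap X Y).inv (pair y' x') (pair x y) ↔ x = x' ∧ y = y' :=
  (pair_inj _ _ _ _).trans and_comm

instance : BraidedCategory RelCat.{u} where
  braiding X Y := swap X Y
  braiding_naturality_right X Y Z f := hom_ext' (by simp)
  braiding_naturality_left f Z := hom_ext' (by simp; grind)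
  hexagon_forward X Y Z := hom_ext' (by simp; grind)
  hexagon_reverse X Y Z := hom_ext' (by simp)

@[simp] theorem holds_braiding_hom (x x' : El X) (y y' : El Y) :
    Holds (β_ X Y).hom (pair x y) (pair y' x') ↔ x = x' ∧ y = y' := holds_swap_hom _ _ _ _

instance : SymmetricCategory RelCat.{u} where
  symmetry X Y := hom_ext' (by simp)

instance : DaggerCategory RelCat.{u} where
  dagger f := ofPred fun y x => Holds f x y
  dagger_id X := hom_ext' (by simp [eq_comm])
  dagger_comp f g := hom_ext' (by simp [and_comm])
  dagger_dagger f := hom_ext' (by simp)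

@[simp] theorem holds_dagger (f : X ⟶ Y) (x : El X) (y : El Y) :
    Holds (dagger f) y x ↔ Holds f x y := Iff.rfl

/-- The cup `I ⟶ X* ⊗ X`, where `X* = X`. -/
def cup (X : RelCat.{u}) : 𝟙_ RelCat.{u} ⟶ X ⊗ X :=
  ofPred fun _ (p : El X × El X) => p.1 = p.2

/-- The cap `X* ⊗ X ⟶ I`, where `X* = X`. -/
def cap (X : RelCat.{u}) : X ⊗ X ⟶ 𝟙_ RelCat.{u} := dagger (cup X)

@[simp] theorem holds_cup (x x' : El X) : Holds (cup X) pt (pair x x') ↔ x = x' := Iff.rfl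

@[simp] theorem holds_cap (x x' : El X) : Holds (cap X) (pair x x') pt ↔ x = x' := Iff.rfl

/-- Every set is its own dual. -/
instance (X : RelCat.{u}) : ExactPairing X X where
  coevaluation' := cup X
  evaluation' := cap X
  coevaluation_evaluation' := hom_ext' (by simp)
  evaluation_coevaluation' := hom_ext' (by simp; grind)

instance (X : RelCat.{u}) : HasRightDual X where
  rightDual := X

/-- With these duals, the transpose `f^* : B* ⟶ A*` of a relation `f : A ⟶ B` is its converse. -/
theorem transpose_eq_dagger (f : X ⟶ Y) : (rightAdjointMate f : Y ⟶ X) = dagger f := by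
  change (ρ_ Y).inv ≫ Y ◁ cup X ≫ Y ◁ f ▷ X ≫ (α_ Y Y X).inv ≫ cap Y ▷ X ≫ (λ_ X).hom = _
  exact hom_ext' (by simp)

end RelDaggerCompact

open RelDaggerCompact

/-! ## Complete positivity and `CPM[Rel]` -/

/-- The conjugate `g_* : A* ⟶ (C ⊗ B)* ≅ B* ⊗ C*` of `g : A ⟶ C ⊗ B`.
Since `X* = X`, and the transpose of a relation is its converse, the conjugate `f_* = (f†)^*` of a
relation `f` is `f` itself, so only the order of the two factors changes. -/
def conjugate {A B C : RelCat.{u}} (g : A ⟶ C ⊗ B) : A ⟶ B ⊗ C := g ≫ (β_ C B).hom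

/-- A morphism `f : A* ⊗ A ⟶ B* ⊗ B` is completely positive when it is of the form
`(id_{B*} ⊗ cap_C ⊗ id_B) ∘ (g_* ⊗ g)` for some object `C` and some `g : A ⟶ C ⊗ B`. -/
def IsCP {A B : RelCat.{u}} (f : A ⊗ A ⟶ B ⊗ B) : Prop :=
  ∃ (C : RelCat.{u}) (g : A ⟶ C ⊗ B),
    f = (conjugate g ⊗ₘ g) ≫ (α_ B C (C ⊗ B)).hom ≫ (B ◁ (α_ C C B).inv) ≫
      (B ◁ (cap C ▷ B)) ≫ (B ◁ (λ_ B).hom)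

theorem isCP_iff {A B : RelCat.{u}} (f : A ⊗ A ⟶ B ⊗ B) :
    IsCP f ↔ ∃ (C : RelCat.{u}) (g : A ⟶ C ⊗ B), ∀ a a' b b',
      Holds f (pair a a') (pair b b') ↔
        ∃ c, Holds g a (pair c b) ∧ Holds g a' (pair c b') := by
  refine exists_congr fun C => exists_congr fun g => ?_
  constructor
  · rintro rfl a a' b b'
    simp [conjugate]
  · intro h
    apply hom_ext'
    simp [conjugate, h]

theorem IsCP.id (A : RelCat.{u}) : IsCP (𝟙 (A ⊗ A)) := by
  rw [isCP_iff]
  refine ⟨𝟙_ _, (λ_ A).inv, ?_⟩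
  simp [eq_comm]

theorem IsCP.comp {A B D : RelCat.{u}} {f : A ⊗ A ⟶ B ⊗ B} {h : B ⊗ B ⟶ D ⊗ D}
    (hf : IsCP f) (hh : IsCP h) : IsCP (f ≫ h) := by
  rw [isCP_iff] at *
  obtain ⟨C, g, hg⟩ := hf
  obtain ⟨E, k, hk⟩ := hh
  refine ⟨C ⊗ E, g ≫ (C ◁ k) ≫ (α_ C E D).inv, ?_⟩
  simp [hg, hk]
  grind

theorem IsCP.dagger {A B : RelCat.{u}} {f : A ⊗ A ⟶ B ⊗ B} (hf : IsCP f) : IsCP (dagger f) := by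
  rw [isCP_iff] at *
  obtain ⟨C, g, hg⟩ := hf
  refine ⟨C, ofPred fun b (q : El C × El A) => Holds g q.2 (pair q.1 b), ?_⟩
  intro b b' a a'
  simp only [holds_dagger, hg]
  rfl

/-- An object of `CPM[Rel]` is a set. -/
@[ext]
structure CPMRel : Type (u + 1) where
  of : RelCat.{u}

namespace CPMRel

/-- A morphism `A ⟶ B` of `CPM[Rel]` is a completely positive map `A* ⊗ A ⟶ B* ⊗ B`. -/
@[ext]
structure Hom (A B : CPMRel.{u}) : Type u where
  hom : A.of ⊗ A.of ⟶ B.of ⊗ B.of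
  cp : IsCP hom

instance : Category CPMRel.{u} where
  Hom := Hom
  id _ := ⟨𝟙 _, IsCP.id _⟩
  comp f g := ⟨f.hom ≫ g.hom, f.cp.comp g.cp⟩
  id_comp _ := Hom.ext (Category.id_comp _)
  comp_id _ := Hom.ext (Category.comp_id _)
  assoc _ _ _ := Hom.ext (Category.assoc _ _ _)

instance : DaggerCategory CPMRel.{u} where
  dagger f := ⟨dagger f.hom, f.cp.dagger⟩
  dagger_id _ := Hom.ext (dagger_id _)
  dagger_comp f g := Hom.ext (dagger_comp f.hom g.hom)
  dagger_dagger f := Hom.ext (dagger_dagger f.hom)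

end CPMRel

/-! ## `CP*[Rel]` -/

namespace DaggerFrobeniusAlgebra

/-- The action map `A ⟶ A* ⊗ A`. -/
def action (A : DaggerFrobeniusAlgebra RelCat.{u}) : A.carrier ⟶ A.carrier ⊗ A.carrier :=
  (λ_ A.carrier).inv ≫ (cup A.carrier ▷ A.carrier) ≫ (α_ A.carrier A.carrier A.carrier).hom ≫
    (A.carrier ◁ A.mul)

/-- The coaction map `A* ⊗ A ⟶ A`. -/
def coaction (A : DaggerFrobeniusAlgebra RelCat.{u}) : A.carrier ⊗ A.carrier ⟶ A.carrier :=
  dagger A.action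

end DaggerFrobeniusAlgebra

/-- An object of `CP*[Rel]`: a normalisable dagger Frobenius algebra in `Rel`, that is, a dagger
Frobenius algebra with a central positive isomorphism `z` such that the counit `unit†` equals the
partial trace of the multiplication with two copies of `z` inserted. -/
structure CPStarRel extends DaggerFrobeniusAlgebra RelCat.{u} where
  z : carrier ⟶ carrier
  central : toDaggerFrobeniusAlgebra.IsCentral z
  positive : IsPositiveMor z
  isIso : IsIso z
  normalise : z ≫ z ≫ toDaggerFrobeniusAlgebra.action ≫ cap carrier = dagger unit

namespace CPStarRel

/-- A morphism `A ⟶ B` of `CP*[Rel]`: a morphism `f` of `Rel` such that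
`action_B ∘ f ∘ coaction_A` is completely positive. -/
@[ext]
structure Hom (A B : CPStarRel.{u}) : Type u where
  hom : A.carrier ⟶ B.carrier
  cp : IsCP (A.coaction ≫ hom ≫ B.action)

section

variable (A : CPStarRel.{u})

/-- A positive isomorphism of `Rel` is an identity. -/
theorem z_eq : A.z = 𝟙 A.carrier := by
  obtain ⟨Y, h, hz⟩ := A.positive
  have := A.isIso
  have h1 := fun x y => holds_congr (IsIso.hom_inv_id A.z) x y
  have h2 := fun x y => holds_congr (IsIso.inv_hom_id A.z) x y
  have hz' := fun x y => holds_congr hz x y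
  simp only [holds_comp, holds_id, holds_dagger] at h1 h2 hz'
  apply hom_ext'
  intro x y
  rw [holds_id]
  have refl : ∀ x, Holds A.z x x := fun x => by
    obtain ⟨y, hy, -⟩ := (h1 x x).2 rfl
    obtain ⟨t, ht, -⟩ := (hz' x y).1 hy
    exact (hz' x x).2 ⟨t, ht, ht⟩
  constructor
  · intro hxy
    obtain ⟨t, ht, -⟩ := (h2 y y).2 rfl
    exact ((h1 x t).1 ⟨y, hxy, ht⟩).trans ((h1 y t).1 ⟨y, refl y, ht⟩).symm
  · rintro rfl
    exact refl x

@[simp] theorem holds_action (a x y : El A.carrier) :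
    Holds A.action a (pair x y) ↔ Holds A.mul (pair x a) y := by
  simp [DaggerFrobeniusAlgebra.action]

@[simp] theorem holds_coaction (a x y : El A.carrier) :
    Holds A.coaction (pair x y) a ↔ Holds A.mul (pair x a) y := by
  simp [DaggerFrobeniusAlgebra.coaction]

theorem mul_assoc_iff (a b c d : El A.carrier) :
    (∃ e, Holds A.mul (pair a b) e ∧ Holds A.mul (pair e c) d) ↔
      ∃ e, Holds A.mul (pair b c) e ∧ Holds A.mul (pair a e) d := by
  simpa using holds_congr A.assoc (pair (pair a b) c) d

theorem unit_mul_iff (a b : El A.carrier) :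
    (∃ e, Holds A.unit pt e ∧ Holds A.mul (pair e a) b) ↔ a = b := by
  simpa using holds_congr A.unit_mul (pair pt a) b

theorem mul_unit_iff (a b : El A.carrier) :
    (∃ e, Holds A.unit pt e ∧ Holds A.mul (pair a e) b) ↔ a = b := by
  simpa using holds_congr A.mul_unit (pair a pt) b

theorem frobenius_left_iff (a b c d : El A.carrier) :
    (∃ e, Holds A.mul (pair e d) b ∧ Holds A.mul (pair a e) c) ↔
      ∃ s, Holds A.mul (pair a b) s ∧ Holds A.mul (pair c d) s := by
  simpa using holds_congr A.frobenius_left (pair a b) (pair c d)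

theorem frobenius_right_iff (a b c d : El A.carrier) :
    (∃ e, Holds A.mul (pair c e) a ∧ Holds A.mul (pair e b) d) ↔
      ∃ s, Holds A.mul (pair a b) s ∧ Holds A.mul (pair c d) s := by
  simpa using holds_congr A.frobenius_right (pair a b) (pair c d)

theorem normalise_iff (a : El A.carrier) :
    (∃ x, Holds A.mul (pair x a) x) ↔ Holds A.unit pt a := by
  have h := holds_congr A.normalise a pt
  rw [z_eq] at h
  simpa using h

theorem mul_right_cancel {x a b y : El A.carrier} (ha : Holds A.mul (pair x a) y)
    (hb : Holds A.mul (pair x b) y) : a = b := by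
  obtain ⟨e, he, he'⟩ := (A.frobenius_left_iff x a x b).2 ⟨y, ha, hb⟩
  exact ((A.unit_mul_iff b a).1 ⟨e, (A.normalise_iff e).1 ⟨x, he'⟩, he⟩).symm

theorem action_comp_coaction : A.action ≫ A.coaction = 𝟙 A.carrier := by
  apply hom_ext'
  intro a b
  simp only [holds_comp, exists_tensor, holds_action, holds_coaction, holds_id]
  constructor
  · rintro ⟨x, y, ha, hb⟩
    exact A.mul_right_cancel ha hb
  · rintro rfl
    obtain ⟨e, -, he⟩ := (A.unit_mul_iff a a).2 rfl
    exact ⟨e, a, he, he⟩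

/-- Every element has an inverse. -/
theorem exists_inverse (x : El A.carrier) : ∃ e w d, Holds A.unit pt e ∧ Holds A.unit pt d ∧
    Holds A.mul (pair e x) x ∧ Holds A.mul (pair x d) x ∧
    Holds A.mul (pair x w) e ∧ Holds A.mul (pair w x) d := by
  obtain ⟨e, he, hex⟩ := (A.unit_mul_iff x x).2 rfl
  obtain ⟨d, hd, hxd⟩ := (A.mul_unit_iff x x).2 rfl
  obtain ⟨w, hw, hw'⟩ := (A.frobenius_left_iff x d e x).2 ⟨x, hxd, hex⟩
  exact ⟨e, w, d, he, hd, hex, hxd, hw', hw⟩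

/-- The multiplication is single-valued. -/
theorem mul_unique {x a y y' : El A.carrier} (h : Holds A.mul (pair x a) y)
    (h' : Holds A.mul (pair x a) y') : y = y' := by
  obtain ⟨e, w, d, he, hd, hex, hxd, hxw, hwx⟩ := A.exists_inverse x
  have key : ∀ t, Holds A.mul (pair x a) t → Holds A.mul (pair w t) a := by
    intro t ht
    obtain ⟨e', he', he't⟩ := (A.unit_mul_iff t t).2 rfl
    obtain ⟨t', ht', ht''⟩ := (A.frobenius_left_iff x a e' t).2 ⟨t, ht, he't⟩
    obtain ⟨r, hr, hr'⟩ := (A.mul_assoc_iff e' x a t).2 ⟨t, ht, he't⟩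
    obtain rfl := (A.unit_mul_iff x r).1 ⟨e', he', hr⟩
    obtain ⟨q, hq, -⟩ := (A.mul_assoc_iff e' e x x).2 ⟨x, hex, hr⟩
    have h1 := (A.unit_mul_iff e q).1 ⟨e', he', hq⟩
    have h2 := (A.mul_unit_iff e' q).1 ⟨e, he, hq⟩
    have : e' = e := h2.trans h1.symm
    subst this
    obtain rfl := A.mul_right_cancel ht'' hxw
    exact ht'
  exact A.mul_right_cancel (key y h) (key y' h')

theorem coaction_action_iff (x x' y y' : El A.carrier) :
    (∃ a, Holds A.mul (pair x a) x' ∧ Holds A.mul (pair y a) y') ↔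
      ∃ c, Holds A.mul (pair c x) y ∧ Holds A.mul (pair c x') y' := by
  constructor
  · rintro ⟨a, hx, hy⟩
    obtain ⟨e, w, d, he, hd, hex, hxd, hxw, hwx⟩ := A.exists_inverse x
    obtain ⟨t, ht, -⟩ := (A.mul_assoc_iff x d a x').1 ⟨x, hxd, hx⟩
    obtain rfl := (A.unit_mul_iff a t).1 ⟨d, hd, ht⟩
    obtain ⟨r, hr, -⟩ := (A.mul_assoc_iff y d a y').2 ⟨a, ht, hy⟩
    obtain rfl := (A.mul_unit_iff y r).1 ⟨d, hd, hr⟩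
    obtain ⟨c, -, hc⟩ := (A.mul_assoc_iff y w x y).2 ⟨d, hwx, hr⟩
    obtain ⟨q, hq, hq'⟩ := (A.mul_assoc_iff c x a y').1 ⟨y, hc, hy⟩
    obtain rfl := A.mul_unique hx hq
    exact ⟨c, hc, hq'⟩
  · rintro ⟨c, hx, hy⟩
    obtain ⟨e, w, d, he, hd, hex, hxd, hxw, hwx⟩ := A.exists_inverse x
    obtain ⟨t, ht, -⟩ := (A.mul_assoc_iff c e x y).2 ⟨x, hex, hx⟩
    obtain rfl := (A.mul_unit_iff c t).1 ⟨e, he, ht⟩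
    obtain ⟨r, hr, -⟩ := (A.mul_assoc_iff c e x' y').1 ⟨c, ht, hy⟩
    obtain rfl := (A.unit_mul_iff x' r).1 ⟨e, he, hr⟩
    obtain ⟨a, -, ha⟩ := (A.mul_assoc_iff x w x' x').1 ⟨e, hxw, hr⟩
    obtain ⟨q, hq, hq'⟩ := (A.mul_assoc_iff c x a y').2 ⟨x', ha, hy⟩
    obtain rfl := A.mul_unique hx hq
    exact ⟨a, ha, hq'⟩

/-- The map `action ∘ coaction` is completely positive. -/
theorem isCP_coaction_action : IsCP (A.coaction ≫ A.action) := by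
  rw [isCP_iff]
  refine ⟨A.carrier, ofPred fun x (q : El A.carrier × El A.carrier) =>
    Holds A.mul (pair q.1 x) q.2, ?_⟩
  intro a a' b b'
  simp only [holds_comp, holds_action, holds_coaction]
  exact A.coaction_action_iff a a' b b'

end

/-- Sandwiching by coaction and action turns composition into composition. -/
theorem sandwich_comp {A B C : CPStarRel.{u}} (f : A.carrier ⟶ B.carrier)
    (g : B.carrier ⟶ C.carrier) :
    A.coaction ≫ (f ≫ g) ≫ C.action =
      (A.coaction ≫ f ≫ B.action) ≫ (B.coaction ≫ g ≫ C.action) := by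
  have h := reassoc_of% B.action_comp_coaction
  simp only [Category.assoc, h]

instance : Category CPStarRel.{u} where
  Hom := Hom
  id A := ⟨𝟙 A.carrier, by rw [Category.id_comp]; exact A.isCP_coaction_action⟩
  comp f g := ⟨f.hom ≫ g.hom, by rw [sandwich_comp]; exact f.cp.comp g.cp⟩
  id_comp _ := Hom.ext (Category.id_comp _)
  comp_id _ := Hom.ext (Category.comp_id _)
  assoc _ _ _ := Hom.ext (Category.assoc _ _ _)

instance : DaggerCategory CPStarRel.{u} where
  dagger {A B} f := ⟨dagger f.hom, by
    have h := f.cp.dagger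
    rwa [dagger_comp, dagger_comp, DaggerFrobeniusAlgebra.coaction, dagger_dagger,
      Category.assoc] at h⟩
  dagger_id _ := Hom.ext (dagger_id _)
  dagger_comp f g := Hom.ext (dagger_comp f.hom g.hom)
  dagger_dagger f := Hom.ext (dagger_dagger f.hom)

end CPStarRel

/-! ## The canonical functor `F : CP*[Rel] ⥤ Split†[CPM[Rel]]` -/

/-- The map `F(A) = action ∘ z ∘ z ∘ coaction` equals `action ∘ coaction`. -/
theorem canonicalFunctor_obj_eq (A : CPStarRel.{u}) :
    A.coaction ≫ A.z ≫ A.z ≫ A.action = A.coaction ≫ A.action := by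
  simp [A.z_eq]

/-- The map `F(f) = action ∘ z ∘ f ∘ z ∘ coaction` equals `action ∘ f ∘ coaction`. -/
theorem canonicalFunctor_map_eq {A B : CPStarRel.{u}} (f : A.carrier ⟶ B.carrier) :
    A.coaction ≫ A.z ≫ f ≫ B.z ≫ B.action = A.coaction ≫ f ≫ B.action := by
  simp [A.z_eq, B.z_eq]

/-- The canonical functor `F : CP*[Rel] ⥤ Split†[CPM[Rel]]`: on objects
`F(A) = (A, action ∘ z ∘ z ∘ coaction)`, on morphisms
`F(f) = action ∘ z ∘ f ∘ z ∘ coaction`. -/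
def canonicalFunctor : CPStarRel.{u} ⥤ SplitDagger CPMRel.{u} where
  obj A :=
    { X := ⟨A.carrier⟩
      p := ⟨A.coaction ≫ A.z ≫ A.z ≫ A.action, by
        rw [canonicalFunctor_obj_eq]; exact A.isCP_coaction_action⟩
      dagger_p := CPMRel.Hom.ext (by
        change dagger (A.coaction ≫ A.z ≫ A.z ≫ A.action) = A.coaction ≫ A.z ≫ A.z ≫ A.action
        rw [canonicalFunctor_obj_eq, dagger_comp, DaggerFrobeniusAlgebra.coaction, dagger_dagger])
      idem := CPMRel.Hom.ext (by
        change (A.coaction ≫ A.z ≫ A.z ≫ A.action) ≫ (A.coaction ≫ A.z ≫ A.z ≫ A.action) =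
          A.coaction ≫ A.z ≫ A.z ≫ A.action
        have h := reassoc_of% A.action_comp_coaction
        simp only [canonicalFunctor_obj_eq, Category.assoc, h]) }
  map {A B} f :=
    { hom := ⟨A.coaction ≫ A.z ≫ f.hom ≫ B.z ≫ B.action, by
        rw [canonicalFunctor_map_eq]; exact f.cp⟩
      comm := CPMRel.Hom.ext (by
        change A.coaction ≫ A.z ≫ f.hom ≫ B.z ≫ B.action =
          (A.coaction ≫ A.z ≫ A.z ≫ A.action) ≫ (A.coaction ≫ A.z ≫ f.hom ≫ B.z ≫ B.action) ≫
            (B.coaction ≫ B.z ≫ B.z ≫ B.action)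
        have hA := reassoc_of% A.action_comp_coaction
        have hB := reassoc_of% B.action_comp_coaction
        simp only [canonicalFunctor_obj_eq, canonicalFunctor_map_eq, Category.assoc, hA, hB]) }
  map_id A := SplitDagger.Hom.ext (CPMRel.Hom.ext (by
    change A.coaction ≫ A.z ≫ 𝟙 _ ≫ A.z ≫ A.action = A.coaction ≫ A.z ≫ A.z ≫ A.action
    rw [Category.id_comp]))
  map_comp {A B C} f g := SplitDagger.Hom.ext (CPMRel.Hom.ext (by
    change A.coaction ≫ A.z ≫ (f.hom ≫ g.hom) ≫ C.z ≫ C.action =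
      (A.coaction ≫ A.z ≫ f.hom ≫ B.z ≫ B.action) ≫ (B.coaction ≫ B.z ≫ g.hom ≫ C.z ≫ C.action)
    simp only [canonicalFunctor_map_eq, CPStarRel.sandwich_comp]))

/-! An object of `CP*[Rel]` is a groupoid in disguise. A positive isomorphism of `Rel` is an
identity (`z_eq`), so normalisation makes the multiplication a partial, single-valued, cancellative
operation with inverses (`mul_unique`, `mul_right_cancel`, `exists_inverse`).

`Split†[CPM[Rel]]` has more objects: a graph with a loop at every vertex, that is, a reflexive
symmetric relation, yields a dagger idempotent (`graphSplitting`). An isomorphism from `F(A)` to it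
puts the elements of `A` in bijection with the ordered edges, and complete positivity makes the left
and right units of an arrow correspond to the loops at the two ends of its edge
(`exists_units_of_isCP`). Consecutive edges are then composable arrows, and their composite is an
edge between the outer ends, so the graph must be transitive (`transitive_of_iso_graphSplitting`). A
graph that is not transitive shows that `F` is not essentially surjective. -/

namespace CPStarRel

/-! ### Units and composability in the underlying groupoid -/

section

variable (A : CPStarRel.{u})

/-- Associativity applied to `d (d' c) = c` shows that `d d'` is defined; a product of two units
equals each of them. -/
theorem left_unit_unique {d d' c : El A.carrier} (hd : Holds A.unit pt d)
    (hd' : Holds A.unit pt d') (h : Holds A.mul (pair d c) c) (h' : Holds A.mul (pair d' c) c) :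
    d = d' := by
  obtain ⟨t, ht, -⟩ := (A.mul_assoc_iff d d' c c).2 ⟨c, h', h⟩
  exact ((A.mul_unit_iff d t).1 ⟨d', hd', ht⟩).trans ((A.unit_mul_iff d' t).1 ⟨d, hd, ht⟩).symm

theorem right_unit_unique {d d' c : El A.carrier} (hd : Holds A.unit pt d)
    (hd' : Holds A.unit pt d') (h : Holds A.mul (pair c d) c) (h' : Holds A.mul (pair c d') c) :
    d = d' := by
  obtain ⟨t, ht, -⟩ := (A.mul_assoc_iff c d d' c).1 ⟨c, h, h'⟩
  exact ((A.mul_unit_iff d t).1 ⟨d', hd', ht⟩).trans ((A.unit_mul_iff d' t).1 ⟨d, hd, ht⟩).symm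

/-- Two elements are composable as soon as they share the unit in between. -/
theorem exists_mul_of_unit {a b d : El A.carrier} (hd : Holds A.unit pt d)
    (ha : Holds A.mul (pair a d) a) (hb : Holds A.mul (pair d b) b) :
    ∃ c, Holds A.mul (pair a b) c := by
  obtain ⟨e, w, -, he, -, heb, -, hbw, -⟩ := A.exists_inverse b
  obtain rfl := A.left_unit_unique hd he hb heb
  -- With `w` inverse to `b`, the product `a (b w) = a d = a` is defined, so by associativity `a b`
  -- is too.
  obtain ⟨c, hc, -⟩ := (A.mul_assoc_iff a b w a).2 ⟨d, hbw, ha⟩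
  exact ⟨c, hc⟩

/-- A completely positive map out of `A* ⊗ A`, precomposed with the action of `A`, is compatible
with left and right units. -/
theorem exists_units_of_isCP {X : RelCat.{u}} {f : A.carrier ⊗ A.carrier ⟶ X ⊗ X} (hf : IsCP f)
    {c : El A.carrier} {q q' : El X} (h : Holds (A.action ≫ f) c (pair q q')) :
    ∃ d d', Holds A.unit pt d ∧ Holds A.unit pt d' ∧
      Holds A.mul (pair d c) c ∧ Holds A.mul (pair c d') c ∧
      Holds (A.action ≫ f) d (pair q q) ∧ Holds (A.action ≫ f) d' (pair q' q') := by
  rw [isCP_iff] at hf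
  obtain ⟨C, g, hg⟩ := hf
  simp only [holds_comp, exists_tensor, holds_action, hg] at h ⊢
  -- Here `x c = y`, and `f` links its two sides only through the common value `k`. Hence `k` with
  -- `x` on both sides relates `(x, x)` to `(q, q)`, and likewise `(y, y)` to `(q', q')`. The action
  -- reaches `(x, x)` and `(y, y)` from the right units of `x` and `y`.
  obtain ⟨x, y, hxy, k, hx, hy⟩ := h
  obtain ⟨-, -, d, -, hd, -, hxd, -, -⟩ := A.exists_inverse x
  obtain ⟨-, -, d', -, hd', -, hyd', -, -⟩ := A.exists_inverse y
  refine ⟨d, d', hd, hd', ?_, ?_, ⟨x, x, hxd, k, hx, hx⟩, ⟨y, y, hyd', k, hy, hy⟩⟩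
  -- Since `(x d) c = x c = y` is defined, so is `d c`, which equals `c` because `d` is a unit.
  · obtain ⟨t, ht, -⟩ := (A.mul_assoc_iff x d c y).1 ⟨x, hxd, hxy⟩
    obtain rfl := (A.unit_mul_iff c t).1 ⟨d, hd, ht⟩
    exact ht
  · obtain ⟨t, ht, -⟩ := (A.mul_assoc_iff x c d' y).1 ⟨y, hxy, hyd'⟩
    obtain rfl := (A.mul_unit_iff c t).1 ⟨d', hd', ht⟩
    exact ht

end

end CPStarRel

/-! ### Dagger idempotents from graphs -/

/-- The restriction of the identity of `X* ⊗ X` to the edges of a graph `r` on `X`. -/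
def graphRestriction (X : RelCat.{u}) (r : El X → El X → Prop) : X ⊗ X ⟶ X ⊗ X :=
  ofPred fun (q q' : El X × El X) => q = q' ∧ r q.1 q.2

@[simp] theorem holds_graphRestriction (X : RelCat.{u}) (r : El X → El X → Prop)
    (a a' b b' : El X) :
    Holds (graphRestriction X r) (pair a a') (pair b b') ↔ (a = b ∧ a' = b') ∧ r a a' :=
  and_congr_left fun _ => pair_inj _ _ _ _

/-- The ancilla records an edge, and each vertex is related to all edges incident with it. Two
vertices have a common incident edge exactly when they are adjacent: reflexivity covers equal
vertices, symmetry the reversed edge. -/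
theorem isCP_graphRestriction {X : RelCat.{u}} {r : El X → El X → Prop} (hr : ∀ x, r x x)
    (hs : ∀ x y, r x y → r y x) : IsCP (graphRestriction X r) := by
  rw [isCP_iff]
  refine ⟨X ⊗ X, ofPred fun a (q : (El X × El X) × El X) =>
    a = q.2 ∧ (q.1.1 = a ∨ q.1.2 = a) ∧ r q.1.1 q.1.2, ?_⟩
  intro a a' b b'
  rw [holds_graphRestriction]
  constructor
  · rintro ⟨⟨rfl, rfl⟩, h⟩
    exact ⟨pair a a', ⟨rfl, Or.inl rfl, h⟩, ⟨rfl, Or.inr rfl, h⟩⟩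
  · rintro ⟨⟨c, c'⟩, ⟨h1, h2, h3⟩, ⟨h4, h5, -⟩⟩
    change a = b at h1
    change a' = b' at h4
    change c = a ∨ c' = a at h2
    change c = a' ∨ c' = a' at h5
    change r c c' at h3
    refine ⟨⟨h1, h4⟩, ?_⟩
    rcases h2 with rfl | rfl <;> rcases h5 with rfl | rfl
    exacts [hr _, h3, hs _ _ h3, hr _]

/-- The dagger idempotent of `CPM[Rel]` given by a reflexive symmetric relation. -/
def graphSplitting (X : RelCat.{u}) (r : El X → El X → Prop) (hr : ∀ x, r x x)
    (hs : ∀ x y, r x y → r y x) : SplitDagger CPMRel.{u} where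
  X := ⟨X⟩
  p := ⟨graphRestriction X r, isCP_graphRestriction hr hs⟩
  dagger_p := CPMRel.Hom.ext <| by
    change dagger (graphRestriction X r) = graphRestriction X r
    exact hom_ext' (by simp; grind)
  idem := CPMRel.Hom.ext <| by
    change graphRestriction X r ≫ graphRestriction X r = graphRestriction X r
    exact hom_ext' (by simp)

/-! ### The essential image contains only transitive graphs -/

/-- A reflexive symmetric relation whose dagger idempotent lies in the essential image of the
canonical functor is transitive. -/
theorem transitive_of_iso_graphSplitting {X : RelCat.{u}} {r : El X → El X → Prop}
    {hr : ∀ x, r x x} {hs : ∀ x y, r x y → r y x} (A : CPStarRel.{u})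
    (i : canonicalFunctor.obj A ≅ graphSplitting X r hr hs) {x y z : El X}
    (hxy : r x y) (hyz : r y z) : r x z := by
  let f : A.carrier ⊗ A.carrier ⟶ X ⊗ X := i.hom.hom.hom
  let g : X ⊗ X ⟶ A.carrier ⊗ A.carrier := i.inv.hom.hom
  have hfg : f ≫ g = A.coaction ≫ A.action :=
    (congrArg (fun k => k.hom.hom) i.hom_inv_id).trans (canonicalFunctor_obj_eq A)
  have hgf : g ≫ f = graphRestriction X r := congrArg (fun k => k.hom.hom) i.inv_hom_id
  have hpf : (A.coaction ≫ A.action) ≫ f = f :=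
    (congrArg (· ≫ f) (canonicalFunctor_obj_eq A)).symm.trans
      (congrArg (fun k => k.hom) i.hom.p_comp)
  -- The idempotent of `A` already splits in `Rel` through the action. So `A.action ≫ f` and `g ≫
  -- A.coaction` are mutually inverse between `A.carrier` and the edge set of `r`; `total`, `surj`,
  -- `inj` and `single` read off this bijection.
  have hφψ : (A.action ≫ f) ≫ (g ≫ A.coaction) = 𝟙 A.carrier := by
    have h := reassoc_of% hfg
    simp [h, A.action_comp_coaction]
  have hψφ : (g ≫ A.coaction) ≫ (A.action ≫ f) = graphRestriction X r := by
    rw [← hgf]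
    simpa using congrArg (g ≫ ·) hpf
  have hcp : IsCP f := i.hom.hom.cp
  generalize g ≫ A.coaction = ψ at hφψ hψφ
  have total (c) : ∃ q q', Holds (A.action ≫ f) c (pair q q') ∧ Holds ψ (pair q q') c := by
    simpa only [holds_comp _ ψ, exists_tensor] using (holds_congr hφψ c c).2 rfl
  have surj {q q'} (h : r q q') :
      ∃ c, Holds ψ (pair q q') c ∧ Holds (A.action ≫ f) c (pair q q') :=
    (holds_congr hψφ (pair q q') (pair q q')).2 (by simpa using h)
  have inj {c c' q q'} (h : Holds (A.action ≫ f) c (pair q q'))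
      (h' : Holds (A.action ≫ f) c' (pair q q')) (hq : r q q') : c = c' := by
    obtain ⟨k, hk, -⟩ := surj hq
    exact ((holds_congr hφψ c k).1 ⟨_, h, hk⟩).trans ((holds_congr hφψ c' k).1 ⟨_, h', hk⟩).symm
  have single {c q q'} (h : Holds ψ (pair q q') c) {s s'}
      (hs : Holds (A.action ≫ f) c (pair s s')) : (q = s ∧ q' = s') ∧ r q q' :=
    (holds_graphRestriction X r q q' s s').1
      ((holds_congr hψφ (pair q q') (pair s s')).1 ⟨c, h, hs⟩)
  obtain ⟨a, -, ha⟩ := surj hxy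
  obtain ⟨b, -, hb⟩ := surj hyz
  obtain ⟨d₁, d₂, hd₁, hd₂, hda, had, h₁, h₂⟩ := A.exists_units_of_isCP hcp ha
  obtain ⟨d₂', d₃, -, hd₃, hdb, hbd, h₂', h₃⟩ := A.exists_units_of_isCP hcp hb
  -- The right unit of `a` and the left unit of `b` both correspond to the loop at `y`, so they
  -- agree and `a b` is defined.
  obtain rfl := inj h₂ h₂' (hr y)
  obtain ⟨c, hc⟩ := A.exists_mul_of_unit hd₂ had hdb
  have hdc : Holds A.mul (pair d₁ c) c := by
    obtain ⟨t, ht, ht'⟩ := (A.mul_assoc_iff d₁ a b c).1 ⟨a, hda, hc⟩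
    rwa [A.mul_unique ht hc] at ht'
  have hcd : Holds A.mul (pair c d₃) c := by
    obtain ⟨t, ht, ht'⟩ := (A.mul_assoc_iff a b d₃ c).2 ⟨b, hbd, hc⟩
    rwa [A.mul_unique ht hc] at ht'
  -- The composite `c` corresponds to some edge `(q, q')`; it remains to identify its ends with `x`
  -- and `z`.
  obtain ⟨q, q', hq, hq'⟩ := total c
  obtain ⟨e, e', he, he', hec, hce, h₄, h₅⟩ := A.exists_units_of_isCP hcp hq
  obtain rfl := A.left_unit_unique he hd₁ hec hdc
  obtain rfl := A.right_unit_unique he' hd₃ hce hcd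
  -- The left unit `e` of `c` is also that of `a`, so it corresponds to the loops at both `q` and
  -- `x`, which must coincide; `e'` treats `q'` and `z` in the same way.
  obtain ⟨s, s', -, hs₁⟩ := total e
  obtain ⟨t, t', -, ht₁⟩ := total e'
  obtain rfl : q = x := (single hs₁ h₄).1.1.symm.trans (single hs₁ h₁).1.1
  obtain rfl : q' = z := (single ht₁ h₅).1.1.symm.trans (single ht₁ h₃).1.1
  exact (single hq' hq).2

/-- The path graph on three vertices is not transitive, so its dagger idempotent is not in the
essential image of the canonical functor. -/
theorem mainTheorem10 : ¬ canonicalFunctor.{u}.IsEquivalence := by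
  intro h
  -- Vertex `1` is the middle of the path, and `0`, `2` are the only non-adjacent pair.
  let r (a b : ULift.{u} (Fin 3)) : Prop := a.down = b.down ∨ a.down = 1 ∨ b.down = 1
  let P := graphSplitting (of (ULift.{u} (Fin 3))) r (fun _ => Or.inl rfl)
    (fun _ _ => Or.imp Eq.symm Or.symm)
  have h02 : r ⟨0⟩ ⟨2⟩ := transitive_of_iso_graphSplitting (canonicalFunctor.objPreimage P)
    (canonicalFunctor.objObjPreimageIso P) (y := (⟨1⟩ : ULift.{u} (Fin 3)))
    (Or.inr (Or.inr rfl)) (Or.inr (Or.inl rfl))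
  simp [r] at h02
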